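/- Let $p_0,p_1,\dots$ be propositional variables. A temporal model $\mathfrak M=(\{0,\dots,\ell\},<,V)$, with $\ell<\omega$, consists of an initial segment of $\mathbb N$ with its strict order and a valuation $V$ mapping each $p_i$ to a set $V(p_i)\subseteq\{0,\dots,\ell\}$. $\mathsf{LTL}$-formulas are built from the $p_i$ by the Booleans, $\bigcirc$, $\Diamond$ and $\mathcal U$. Their truth at $n\le\ell$ is defined by: $\mathfrak M,n\models p_i$ iff $n\in V(p_i)$; the usual clauses for the Booleans; $\mathfrak M,n\models\bigcirc\varphi$ iff $n<\ell$ and $\mathfrak M,n+1\models\varphi$; $\mathfrak M,n\models\Diamond\varphi$ iff $\mathfrak M,m\models\varphi$ for some $m$ with $n<m\le\ell$; $\mathfrak M,n\models\varphi\,\mathcal U\,\psi$ iff there is $m$ with $n<m\le\ell$, $\mathfrak M,m\models\varphi$, and $\mathfrak M,k\models\psi$ for all $k$ with $n<k<m$. An $\exists\mathsf{LTL}$-formula is $\exists q_1\dots\exists q_k\,\varphi$, where $k\ge 0$, the $q_j$ are propositional variables and $\varphi$ is an $\mathsf{LTL}$-formula; $\mathfrak M,n\models\exists q\,\varphi$ iff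 $\mathfrak M',n\models\varphi$ for some $\mathfrak M'$ that differs from $\mathfrak M$ at most in the interpretation of $q$. Let $\sigma_{\mathrm{lin}}$ be the signature with a binary predicate $<$ and unary predicates $P_0,P_1,\dots$; a temporal model is a $\sigma_{\mathrm{lin}}$-structure in which $P_i$ is interpreted as $V(p_i)$. $\mathsf{MSO}$ is monadic second-order logic with equality. (a) For every $\mathsf{MSO}$-formula $\vartheta(x)$ in the signature $\sigma_{\mathrm{lin}}$ with one free first-order variable $x$ (and no free second-order variables), there is an $\exists\mathsf{LTL}$-formula $\varphi_\vartheta$ such that, for all temporal models $\mathfrak M$, $$\mathfrak M\models\vartheta(0)\quad\text{iff}\quad \mathfrak M,0\models\varphi_\vartheta .$$ (b) Let $A$ be a finite alphabet whose letters are identified with pairwise distinct propositional variables, so that each nonempty word $w=a_0\dots a_\ell\in A^+$ is a temporal model in which the variable $a\in A$ is true exactly at those $i\le\ell$ with $a_i=a$, and all variables outside $A$ are false everywhere. A language $L\subseteq A^+$ is regular if and only if it is $\exists\mathsf{LTL}$-definable, that is, $L=\{w\in A^+\mid w,0\models\varphi\}$ for some $\exists\mathsf{LTL}$-formula $\varphi$.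 -/

import Mathlib

/-- A temporal model with time line `{0, …, ℓ}` (ordered as usual): a valuation of the propositional
variables `p_0, p_1, …` by sets of time points. It is also regarded as a relational structure
with the binary predicate `<` and the unary predicates `P_0, P_1, …`, `P_i` being
interpreted by the value of `p_i`. -/
structure TemporalModel (ℓ : ℕ) where
  val : ℕ → Set (Fin (ℓ + 1))

/-- `LTL`-formulas over the propositional variables `p_0, p_1, …`. -/
inductive LTL : Type
  | top : LTL
  | var (i : ℕ) : LTL
  | not (φ : LTL) : LTL
  | and (φ ψ : LTL) : LTL
  | next (φ : LTL) : LTL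
  | dia (φ : LTL) : LTL
  | untl (φ ψ : LTL) : LTL

/-- Truth of an `LTL`-formula at a time point, under the strict semantics of `◇` and `U`.
In `φ U ψ` it is `φ` that eventually holds, and `ψ` holds strictly in between. -/
def LTL.Sat {ℓ : ℕ} (M : TemporalModel ℓ) : LTL → Fin (ℓ + 1) → Prop
  | .top, _ => True
  | .var i, n => n ∈ M.val i
  | .not φ, n => ¬ LTL.Sat M φ n
  | .and φ ψ, n => LTL.Sat M φ n ∧ LTL.Sat M ψ n
  | .next φ, n => ∃ h : (n : ℕ) < ℓ, LTL.Sat M φ ⟨n + 1, Nat.succ_lt_succ h⟩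
  | .dia φ, n => ∃ m, n < m ∧ LTL.Sat M φ m
  | .untl φ ψ, n => ∃ m, n < m ∧ LTL.Sat M φ m ∧ ∀ k, n < k → k < m → LTL.Sat M ψ k

/-- `∃LTL`-formulas: `LTL`-formulas possibly prefixed by quantifiers `∃q` over propositional
variables. -/
inductive ELTL : Type
  | ofLTL (φ : LTL) : ELTL
  | ex (q : ℕ) (φ : ELTL) : ELTL

/-- Truth of an `∃LTL`-formula: `∃q φ` holds in `M` at `n` iff `φ` holds at `n` in some `M'`
that may differ from `M` only on `q`. -/
def ELTL.Sat {ℓ : ℕ} : TemporalModel ℓ → ELTL → Fin (ℓ + 1) → Prop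
  | M, .ofLTL φ, n => φ.Sat M n
  | M, .ex q φ, n => ∃ M' : TemporalModel ℓ, (∀ p, p ≠ q → M'.val p = M.val p) ∧ ELTL.Sat M' φ n

/-- Formulas of monadic second-order logic with equality over the binary predicate `<` and the
unary predicates `P_0, P_1, …`, whose free first-order variables are among `x_0, …, x_{n-1}` and
whose free set variables are among `X_0, …, X_{m-1}`. The quantifiers bind the variable
with index `0` and the indices of the other variables are shifted by one in their scope. -/
inductive MSO : ℕ → ℕ → Type
  | top {n m : ℕ} : MSO n m
  | lt {n m : ℕ} (x y : Fin n) : MSO n m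
  | eq {n m : ℕ} (x y : Fin n) : MSO n m
  | pred {n m : ℕ} (i : ℕ) (x : Fin n) : MSO n m
  | mem {n m : ℕ} (x : Fin n) (X : Fin m) : MSO n m
  | not {n m : ℕ} (φ : MSO n m) : MSO n m
  | and {n m : ℕ} (φ ψ : MSO n m) : MSO n m
  | ex {n m : ℕ} (φ : MSO (n + 1) m) : MSO n m
  | exSet {n m : ℕ} (φ : MSO n (m + 1)) : MSO n m

/-- Truth of an `MSO`-formula in the structure `M`, where `v` assigns elements to the free
first-order variables and `S` assigns sets of elements to the free set variables. -/
def MSO.Sat {ℓ : ℕ} (M : TemporalModel ℓ) : {n m : ℕ} → MSO n m →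
    (Fin n → Fin (ℓ + 1)) → (Fin m → Set (Fin (ℓ + 1))) → Prop
  | _, _, .top, _, _ => True
  | _, _, .lt x y, v, _ => v x < v y
  | _, _, .eq x y, v, _ => v x = v y
  | _, _, .pred i x, v, _ => v x ∈ M.val i
  | _, _, .mem x X, v, S => v x ∈ S X
  | _, _, .not φ, v, S => ¬ MSO.Sat M φ v S
  | _, _, .and φ ψ, v, S => MSO.Sat M φ v S ∧ MSO.Sat M ψ v S
  | _, _, .ex φ, v, S => ∃ a : Fin (ℓ + 1), MSO.Sat M φ (Fin.cons a v) S
  | _, _, .exSet φ, v, S => ∃ B : Set (Fin (ℓ + 1)), MSO.Sat M φ v (Fin.cons B S)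

/-- The temporal model with time points `0, …, |w| - 1` given by a nonempty word `w`, where the
letters are regarded as propositional variables via the injection `ι`: the variable `ι a` is
true exactly at the positions where the letter is `a`, and no other variable is ever true.
(Only used for `w ≠ []`.) -/
def wordModel {A : Type*} (ι : A ↪ ℕ) (w : List A) : TemporalModel (w.length - 1) where
  val p := {n | ∃ a, w[(n : ℕ)]? = some a ∧ ι a = p}

/-- A language `L ⊆ A⁺` is `∃LTL`-definable if `L = {w ∈ A⁺ | w, 0 ⊨ φ}` for some
`∃LTL`-formula `φ`. -/
def ELTLDefinable {A : Type*} (ι : A ↪ ℕ) (L : Language A) : Prop :=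
  ∃ φ : ELTL, ∀ w : List A, w ∈ L ↔ w ≠ [] ∧ φ.Sat (wordModel ι w) 0

/-!
The three formalisms are compared over finite words by going round a circle.

* From `MSO` to regular languages (`MSO.exists_isRegular`): a formula with free variables is a
  property of words over an alphabet extended by one bit (a track) for each free variable. Atomic
  formulas are recognized by small automata, negation and conjunction are complement and
  intersection, and a quantifier erases a track, that is, takes the image under a letter-to-letter
  map (`Language.isRegular_map`). For a first-order quantifier the language is first restricted to
  the words in which the erased track marks exactly one position.
* From regular languages to `∃LTL` (`ELTL.exists_of_isRegular`): the quantified fresh variables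
  guess the run of a deterministic automaton, and an `LTL`-formula checks at each position that
  the guess is correct and that the last transition leads to an accepting state.
* From `∃LTL` to `MSO` (`ELTL.sat_toMSO`): this is the standard translation.

The first two steps give both part (a), over the alphabet of truth assignments to the variables
that occur in the given formula, and one half of part (b); the third and the first give the other
half.
-/

/-! ### Closure properties of regular languages, and two families of examples -/

namespace Language

universe u

variable {α : Type u} {β : Type u}

/-- The image of a regular language under a letter-to-letter map is regular: a nondeterministic
automaton guesses the preimages of the letters. -/
theorem isRegular_map (f : α → β) {L : Language α} (h : L.IsRegular) :
    (Language.map f L).IsRegular := by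
  obtain ⟨σ, _, D, rfl⟩ := h
  let N : NFA β σ := ⟨fun s b => {t | ∃ a, f a = b ∧ D.step s a = t}, {D.start}, D.accept⟩
  have key : ∀ (w : List β) (s t : σ),
      t ∈ N.evalFrom {s} w ↔ ∃ u : List α, u.map f = w ∧ D.evalFrom s u = t := by
    intro w
    induction w with
    | nil => intro s t; simp [eq_comm]
    | cons b w ih =>
      intro s t
      rw [NFA.evalFrom_cons, NFA.mem_evalFrom_iff_exists]
      simp only [NFA.stepSet_singleton, ih]
      constructor
      · rintro ⟨r, ⟨a, rfl, rfl⟩, u, rfl, rfl⟩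
        exact ⟨a :: u, rfl, rfl⟩
      · rintro ⟨u, hu, rfl⟩
        obtain ⟨a, u, rfl, rfl, rfl⟩ := List.map_eq_cons_iff.1 hu
        exact ⟨D.step s a, ⟨a, rfl, rfl⟩, u, rfl, rfl⟩
  refine Language.isRegular_iff.2 ⟨Set σ, inferInstance, N.toDFA, ?_⟩
  rw [NFA.toDFA_correct]
  ext w
  rw [NFA.mem_accepts]
  change (∃ S ∈ D.accept, S ∈ N.evalFrom {D.start} w) ↔ ∃ u ∈ D.accepts, u.map f = w
  simp only [key]
  constructor
  · rintro ⟨_, hS, u, hu, rfl⟩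
    exact ⟨u, hS, hu⟩
  · rintro ⟨u, hS, hu⟩
    exact ⟨_, hS, u, hu, rfl⟩

theorem mem_map_iff (f : α → β) (L : Language α) (w : List β) :
    w ∈ Language.map f L ↔ ∃ u ∈ L, u.map f = w := Iff.rfl

theorem mem_compl_iff (L : Language α) (w : List α) : w ∈ Lᶜ ↔ w ∉ L := Iff.rfl

theorem exists_isRegular_comap (f : α → β) {L : Language β} (h : L.IsRegular) :
    ∃ L' : Language α, L'.IsRegular ∧ ∀ w, w ∈ L' ↔ w.map f ∈ L := by
  obtain ⟨σ, _, D, rfl⟩ := h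
  exact ⟨(D.comap f).accepts, ⟨σ, inferInstance, _, rfl⟩, fun w => by
    rw [DFA.mem_accepts, DFA.eval_comap]; rfl⟩

theorem exists_isRegular_exists_mem (P : α → Prop) :
    ∃ L : Language α, L.IsRegular ∧ ∀ w, w ∈ L ↔ ∃ c ∈ w, P c := by
  let D : DFA α Prop := ⟨fun s c => s ∨ P c, False, {s | s}⟩
  have key : ∀ (w : List α) (s : Prop), D.evalFrom s w ↔ s ∨ ∃ c ∈ w, P c := by
    intro w
    induction w with
    | nil => simp
    | cons c w ih =>
      intro s
      rw [DFA.evalFrom_cons, ih]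
      simp [D, or_assoc]
  refine ⟨D.accepts, Language.isRegular_iff.2 ⟨Prop, inferInstance, D, rfl⟩, fun w => ?_⟩
  rw [← false_or (∃ c ∈ w, P c), ← key w False]
  rfl

/-- Its complement consists of the words in which a letter satisfying `P` occurs before a letter
satisfying `Q`. -/
theorem exists_isRegular_pairwise (P Q : α → Prop) :
    ∃ L : Language α, L.IsRegular ∧ ∀ w, w ∈ L ↔ w.Pairwise fun a b => ¬ (P a ∧ Q b) := by
  -- The state records whether `P` has occurred, and whether no forbidden pair has occurred.
  let D : DFA α (Prop × Prop) :=
    ⟨fun s c => (s.1 ∨ P c, s.2 ∧ ¬ (s.1 ∧ Q c)), (False, True), {s | s.2}⟩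
  have key : ∀ (w : List α) (s : Prop × Prop), (D.evalFrom s w).2 ↔
      s.2 ∧ (s.1 → ∀ c ∈ w, ¬ Q c) ∧ w.Pairwise fun a b => ¬ (P a ∧ Q b) := by
    intro w
    induction w with
    | nil => simp
    | cons c w ih =>
      intro s
      rw [DFA.evalFrom_cons, ih, List.pairwise_cons]
      simp only [D, List.forall_mem_cons]
      by_cases h1 : s.1 <;> by_cases h2 : P c <;> simp [h1, h2]
      · tauto
      · tauto
  refine ⟨D.accepts, Language.isRegular_iff.2 ⟨Prop × Prop, inferInstance, D, rfl⟩, fun w => ?_⟩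
  have := key w (False, True)
  simp only [true_and, false_imp_iff] at this
  rw [← this]
  rfl

end Language

theorem List.exists_ofFn_of_map_eq_ofFn {α β : Type*} {p : α → β} {n : ℕ} {g : Fin n → β}
    {w : List α} (h : w.map p = List.ofFn g) :
    ∃ e : Fin n → α, w = List.ofFn e ∧ ∀ k, p (e k) = g k := by
  obtain rfl : w.length = n := by simpa using congrArg List.length h
  refine ⟨w.get, (List.ofFn_get w).symm, fun k => ?_⟩
  have hw : w.map p = List.ofFn (p ∘ w.get) := by rw [← List.map_ofFn, List.ofFn_get]
  exact congrFun (List.ofFn_injective (hw.symm.trans h)) k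

theorem List.exists_mem_ofFn_iff {α : Type*} {P : α → Prop} {n : ℕ} {g : Fin n → α} :
    (∃ c ∈ List.ofFn g, P c) ↔ ∃ k, P (g k) := by
  simp [List.mem_ofFn]

/-! ### From monadic second-order logic to regular languages -/

namespace MSO

/-- A strict upper bound on the indices of the predicates occurring in a formula. -/
def bound : {n m : ℕ} → MSO n m → ℕ
  | _, _, .top => 0
  | _, _, .lt _ _ => 0
  | _, _, .eq _ _ => 0
  | _, _, .pred i _ => i + 1
  | _, _, .mem _ _ => 0
  | _, _, .not φ => φ.bound
  | _, _, .and φ ψ => max φ.bound ψ.bound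
  | _, _, .ex φ => φ.bound
  | _, _, .exSet φ => φ.bound

/-- The extended alphabet: a letter of `A`, together with one bit for each free variable. -/
abbrev Letter (A : Type*) (n m : ℕ) := A × (Fin n → Prop) × (Fin m → Prop)

/-- The word over the extended alphabet which expands the word `f` by the characteristic
functions of the values of the variables. -/
def enc {A : Type*} {ℓ n m : ℕ} (f : Fin (ℓ + 1) → A) (v : Fin n → Fin (ℓ + 1))
    (S : Fin m → Set (Fin (ℓ + 1))) (k : Fin (ℓ + 1)) : Letter A n m :=
  (f k, fun x => v x = k, fun X => k ∈ S X)

/-- The alphabet `A` carries an interpretation `V` of the predicates; the models considered are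
those which agree, on the predicates that occur in `φ`, with a word over `A`. -/
theorem exists_isRegular {A : Type*} (V : A → Set ℕ) {n m : ℕ} (φ : MSO n m) :
    ∃ L : Language (Letter A n m), L.IsRegular ∧
      ∀ (ℓ : ℕ) (M : TemporalModel ℓ) (f : Fin (ℓ + 1) → A),
        (∀ i < φ.bound, ∀ k, k ∈ M.val i ↔ i ∈ V (f k)) →
        ∀ v S, φ.Sat M v S ↔ List.ofFn (enc f v S) ∈ L := by
  induction φ with
  | top =>
    obtain ⟨L, hL, h⟩ := Language.exists_isRegular_pairwise
      (fun _ : Letter A _ _ => False) (fun _ => False)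
    refine ⟨L, hL, fun ℓ M f hf v S => ?_⟩
    simp [h, MSO.Sat, List.pairwise_ofFn]
  | lt x y =>
    obtain ⟨L, hL, h⟩ := Language.exists_isRegular_pairwise
      (fun c : Letter A _ _ => c.2.1 x) (fun c => c.2.1 y)
    refine ⟨Lᶜ, hL.compl, fun ℓ M f hf v S => ?_⟩
    rw [Language.mem_compl_iff, h, List.pairwise_ofFn]
    simp [MSO.Sat, enc]
  | eq x y =>
    obtain ⟨L, hL, h⟩ := Language.exists_isRegular_exists_mem
      (fun c : Letter A _ _ => c.2.1 x ∧ c.2.1 y)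
    refine ⟨L, hL, fun ℓ M f hf v S => ?_⟩
    rw [h, List.exists_mem_ofFn_iff]
    simp [MSO.Sat, enc, eq_comm]
  | pred i x =>
    obtain ⟨L, hL, h⟩ := Language.exists_isRegular_exists_mem
      (fun c : Letter A _ _ => c.2.1 x ∧ i ∈ V c.1)
    refine ⟨L, hL, fun ℓ M f hf v S => ?_⟩
    rw [h, List.exists_mem_ofFn_iff]
    simp [MSO.Sat, enc, hf i (Nat.lt_succ_self i)]
  | mem x X =>
    obtain ⟨L, hL, h⟩ := Language.exists_isRegular_exists_mem
      (fun c : Letter A _ _ => c.2.1 x ∧ c.2.2 X)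
    refine ⟨L, hL, fun ℓ M f hf v S => ?_⟩
    rw [h, List.exists_mem_ofFn_iff]
    simp [MSO.Sat, enc]
  | not φ ih =>
    obtain ⟨L, hL, h⟩ := ih
    refine ⟨Lᶜ, hL.compl, fun ℓ M f hf v S => ?_⟩
    rw [Language.mem_compl_iff, ← h ℓ M f hf]
    rfl
  | and φ ψ ih₁ ih₂ =>
    obtain ⟨L₁, hL₁, h₁⟩ := ih₁
    obtain ⟨L₂, hL₂, h₂⟩ := ih₂
    refine ⟨L₁ ⊓ L₂, hL₁.inf hL₂, fun ℓ M f hf v S => ?_⟩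
    rw [Language.mem_inf, ← h₁ ℓ M f fun i hi => hf i (lt_max_of_lt_left hi),
      ← h₂ ℓ M f fun i hi => hf i (lt_max_of_lt_right hi)]
    rfl
  | @ex n m φ ih =>
    obtain ⟨L, hL, h⟩ := ih
    obtain ⟨L₁, hL₁, h₁⟩ := Language.exists_isRegular_exists_mem
      (fun c : Letter A (n + 1) m => c.2.1 0)
    obtain ⟨L₂, hL₂, h₂⟩ := Language.exists_isRegular_pairwise
      (fun c : Letter A (n + 1) m => c.2.1 0) (fun c => c.2.1 0)
    let p : Letter A (n + 1) m → Letter A n m := fun c => (c.1, Fin.tail c.2.1, c.2.2)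
    refine ⟨_, Language.isRegular_map p (hL.inf (hL₁.inf hL₂)), fun ℓ M f hf v S => ?_⟩
    simp only [Language.mem_map_iff, Language.mem_inf, h₁, h₂]
    constructor
    · rintro ⟨a, ha⟩
      refine ⟨List.ofFn (enc f (Fin.cons a v) S), ⟨(h ℓ M f hf _ _).1 ha, ?_, ?_⟩, ?_⟩
      · exact List.exists_mem_ofFn_iff.2 ⟨a, rfl⟩
      · simp only [List.pairwise_ofFn, enc, Fin.cons_zero]
        rintro i j hij ⟨rfl, rfl⟩
        exact hij.false
      · rw [List.map_ofFn]
        rfl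
    · rintro ⟨w, ⟨hw, hw₁, hw₂⟩, hp⟩
      obtain ⟨e, rfl, he⟩ := List.exists_ofFn_of_map_eq_ofFn hp
      obtain ⟨a, hc0⟩ := List.exists_mem_ofFn_iff.1 hw₁
      rw [List.pairwise_ofFn] at hw₂
      -- The additional track of `e` marks exactly the position `a`.
      have htrack : ∀ k, (e k).2.1 0 ↔ a = k := by
        intro k
        constructor
        · intro hk
          rcases lt_trichotomy a k with hlt | heq | hlt
          · exact (hw₂ hlt ⟨hc0, hk⟩).elim
          · exact heq
          · exact (hw₂ hlt ⟨hk, hc0⟩).elim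
        · rintro rfl
          exact hc0
      have hee : e = enc f (Fin.cons a v) S := by
        funext k
        have hk := he k
        simp only [p, enc, Prod.mk.injEq] at hk
        refine Prod.ext hk.1 (Prod.ext (funext fun x => ?_) hk.2.2)
        refine Fin.cases ?_ (fun x => ?_) x
        · exact propext (htrack k)
        · exact congrFun hk.2.1 x
      exact ⟨a, (h ℓ M f hf _ _).2 (hee ▸ hw)⟩
  | @exSet n m φ ih =>
    obtain ⟨L, hL, h⟩ := ih
    let p : Letter A n (m + 1) → Letter A n m := fun c => (c.1, c.2.1, Fin.tail c.2.2)
    refine ⟨_, Language.isRegular_map p hL, fun ℓ M f hf v S => ?_⟩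
    rw [Language.mem_map_iff]
    constructor
    · rintro ⟨B, hB⟩
      refine ⟨List.ofFn (enc f v (Fin.cons B S)), (h ℓ M f hf _ _).1 hB, ?_⟩
      rw [List.map_ofFn]
      rfl
    · rintro ⟨w, hw, hp⟩
      obtain ⟨e, rfl, he⟩ := List.exists_ofFn_of_map_eq_ofFn hp
      have hee : e = enc f v (Fin.cons {k | (e k).2.2 0} S) := by
        funext k
        have hk := he k
        simp only [p, enc, Prod.mk.injEq] at hk
        refine Prod.ext hk.1 (Prod.ext hk.2.1 (funext fun X => ?_))
        refine Fin.cases rfl (fun X => ?_) X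
        exact congrFun hk.2.2 X
      exact ⟨_, (h ℓ M f hf _ _).2 (hee ▸ hw)⟩

/-- The sentence stating that the formula `θ(x)` holds of the first time point. It makes no
reference to a marked position, so its words need no additional track. -/
def atZero (θ : MSO 1 0) : MSO 0 0 :=
  .ex (.and (.not (.ex (.lt 0 1))) θ)

theorem sat_atZero {ℓ : ℕ} (M : TemporalModel ℓ) (θ : MSO 1 0) (v : Fin 0 → Fin (ℓ + 1))
    (S : Fin 0 → Set (Fin (ℓ + 1))) : θ.atZero.Sat M v S ↔ θ.Sat M ![0] ![] := by
  have hv : v = ![] := Subsingleton.elim _ _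
  have hS : S = ![] := Subsingleton.elim _ _
  subst hv hS
  constructor
  · rintro ⟨a, ha, hθ⟩
    obtain rfl : a = 0 := by
      by_contra h
      exact ha ⟨0, Fin.pos_of_ne_zero h⟩
    exact hθ
  · intro h
    refine ⟨0, ?_, h⟩
    rintro ⟨b, hb⟩
    exact absurd hb (Fin.not_lt_zero b)

theorem exists_isRegular_atZero {A : Type*} (V : A → Set ℕ) (θ : MSO 1 0) :
    ∃ L : Language A, L.IsRegular ∧
      ∀ (ℓ : ℕ) (M : TemporalModel ℓ) (f : Fin (ℓ + 1) → A),
        (∀ i < θ.bound, ∀ k, k ∈ M.val i ↔ i ∈ V (f k)) →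
        (θ.Sat M ![0] ![] ↔ List.ofFn f ∈ L) := by
  obtain ⟨L, hL, h⟩ := exists_isRegular V θ.atZero
  obtain ⟨L', hL', h'⟩ := Language.exists_isRegular_comap
    (fun a => ((a, Fin.elim0, Fin.elim0) : Letter A 0 0)) hL
  refine ⟨L', hL', fun ℓ M f hf => ?_⟩
  have hb : θ.atZero.bound = θ.bound := by simp [atZero, bound]
  rw [← sat_atZero M θ ![] ![], h ℓ M f (hb ▸ hf), h', List.map_ofFn]
  have : enc f ![] ![] = (fun a => ((a, Fin.elim0, Fin.elim0) : Letter A 0 0)) ∘ f :=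
    funext fun k => Prod.ext rfl (Prod.ext (Subsingleton.elim _ _) (Subsingleton.elim _ _))
  rw [this]

end MSO

/-! ### From regular languages to `∃LTL` -/

namespace LTL

/-- A strict upper bound on the indices of the variables occurring in a formula. -/
def bound : LTL → ℕ
  | .top => 0
  | .var i => i + 1
  | .not φ => φ.bound
  | .and φ ψ => max φ.bound ψ.bound
  | .next φ => φ.bound
  | .dia φ => φ.bound
  | .untl φ ψ => max φ.bound ψ.bound

theorem sat_congr {ℓ : ℕ} {M N : TemporalModel ℓ} (φ : LTL)
    (h : ∀ i < φ.bound, M.val i = N.val i) (n : Fin (ℓ + 1)) : φ.Sat M n ↔ φ.Sat N n := by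
  induction φ generalizing n with
  | top => rfl
  | var i => simp [LTL.Sat, h i (Nat.lt_succ_self i)]
  | not φ ih => simp [LTL.Sat, ih h]
  | and φ ψ ih₁ ih₂ =>
    simp [LTL.Sat, ih₁ fun i hi => h i (lt_max_of_lt_left hi),
      ih₂ fun i hi => h i (lt_max_of_lt_right hi)]
  | next φ ih => simp [LTL.Sat, ih h]
  | dia φ ih => simp [LTL.Sat, ih h]
  | untl φ ψ ih₁ ih₂ =>
    simp [LTL.Sat, ih₁ fun i hi => h i (lt_max_of_lt_left hi),
      ih₂ fun i hi => h i (lt_max_of_lt_right hi)]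

/-- Implication. -/
def imp (φ ψ : LTL) : LTL := .not (.and φ (.not ψ))

theorem sat_imp {ℓ : ℕ} (M : TemporalModel ℓ) (φ ψ : LTL) (n : Fin (ℓ + 1)) :
    (φ.imp ψ).Sat M n ↔ (φ.Sat M n → ψ.Sat M n) := by
  simp [imp, LTL.Sat]

/-- The conjunction of a list of formulas. -/
def conj (l : List LTL) : LTL := l.foldr .and .top

theorem sat_conj {ℓ : ℕ} (M : TemporalModel ℓ) (l : List LTL) (n : Fin (ℓ + 1)) :
    (conj l).Sat M n ↔ ∀ φ ∈ l, φ.Sat M n := by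
  induction l with
  | nil => simp [conj, LTL.Sat]
  | cons φ l ih =>
    rw [List.forall_mem_cons, ← ih]
    rfl

theorem exists_forall_sat {ι : Type*} [Finite ι] (φ : ι → LTL) :
    ∃ ψ : LTL, ∀ (ℓ : ℕ) (M : TemporalModel ℓ) (n : Fin (ℓ + 1)),
      ψ.Sat M n ↔ ∀ i, (φ i).Sat M n := by
  have := Fintype.ofFinite ι
  refine ⟨conj (Finset.univ.toList.map φ), fun ℓ M n => ?_⟩
  simp [sat_conj]

/-- The formula `φ` holds now and at all later time points. -/
def always (φ : LTL) : LTL := .and φ (.not (.dia (.not φ)))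

theorem sat_always_zero {ℓ : ℕ} (M : TemporalModel ℓ) (φ : LTL) :
    φ.always.Sat M 0 ↔ ∀ n, φ.Sat M n := by
  constructor
  · rintro ⟨h0, h⟩ n
    rcases Fin.eq_zero_or_eq_succ n with rfl | ⟨j, rfl⟩
    · exact h0
    · by_contra hn
      exact h ⟨_, Fin.succ_pos j, hn⟩
  · intro h
    refine ⟨h 0, ?_⟩
    rintro ⟨m, -, hm⟩
    exact hm (h m)

end LTL

namespace ELTL

/-- The formula `∃ p_{K + N - 1} … ∃ p_K φ`. -/
def exBlock (K : ℕ) (φ : LTL) : ℕ → ELTL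
  | 0 => .ofLTL φ
  | N + 1 => .ex (K + N) (exBlock K φ N)

theorem sat_exBlock {ℓ : ℕ} (K N : ℕ) (φ : LTL) (M : TemporalModel ℓ) (n : Fin (ℓ + 1)) :
    (exBlock K φ N).Sat M n ↔ ∃ M' : TemporalModel ℓ,
      (∀ p, p < K ∨ K + N ≤ p → M'.val p = M.val p) ∧ φ.Sat M' n := by
  induction N generalizing M with
  | zero =>
    constructor
    · intro h
      exact ⟨M, fun _ _ => rfl, h⟩
    · rintro ⟨M', hM', h⟩
      have : M' = M := by
        cases M'; cases M
        congr 1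
        exact funext fun p => hM' p (lt_or_ge p K)
      exact this ▸ h
  | succ N ih =>
    simp only [exBlock, ELTL.Sat, ih]
    constructor
    · rintro ⟨M₁, h₁, M₂, h₂, h⟩
      refine ⟨M₂, fun p hp => ?_, h⟩
      rw [h₂ p (by omega), h₁ p (by omega)]
    · rintro ⟨M', hM', h⟩
      refine ⟨⟨Function.update M.val (K + N) (M'.val (K + N))⟩, fun p hp => ?_, M',
        fun p hp => ?_, h⟩
      · exact Function.update_of_ne hp _ _
      · by_cases hpK : p = K + N
        · subst hpK
          simp
        · simp only [Function.update_of_ne hpK]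
          exact hM' p (by omega)

/-- The letters are given by formulas `χ c`, each true exactly at the positions with letter `c`.
The formula of the conclusion guesses, in fresh variables, a labelling of each position `i` by the
states in which the automaton may be before it reads the letter at `i`. -/
theorem exists_of_isRegular {α : Type*} [Finite α] (χ : α → LTL) {L : Language α}
    (hL : L.IsRegular) :
    ∃ φ : ELTL, ∀ (ℓ : ℕ) (M : TemporalModel ℓ) (f : Fin (ℓ + 1) → α),
      (∀ n c, (χ c).Sat M n ↔ f n = c) → (φ.Sat M 0 ↔ List.ofFn f ∈ L) := by
  classical
  obtain ⟨σ, _, D, rfl⟩ := hL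
  obtain ⟨K, hK⟩ : ∃ K, ∀ c, (χ c).bound ≤ K := by
    obtain ⟨K, hK⟩ := (Set.finite_range fun c => (χ c).bound).bddAbove
    exact ⟨K, fun c => hK ⟨c, rfl⟩⟩
  let e := Fintype.equivFin σ
  let q : σ → LTL := fun s => .var (K + e s)
  -- The labelling need not be functional: if it has the initial state at position `0` and
  -- is closed under transitions, then it contains the run, and the condition imposed on all last
  -- transitions applies to the last transition of the run.
  obtain ⟨ψ, hψ⟩ := LTL.exists_forall_sat fun z : σ × α =>
    LTL.imp (.and (q z.1) (χ z.2))
      (.and (LTL.imp (.next .top) (.next (q (D.step z.1 z.2))))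
        (if D.step z.1 z.2 ∈ D.accept then .top else .next .top))
  refine ⟨exBlock K (.and (q D.start) ψ.always) (Fintype.card σ), fun ℓ M f hf => ?_⟩
  rw [sat_exBlock]
  -- The state of the automaton before it reads the letter at position `k`.
  let run : ℕ → σ := fun k => D.eval ((List.ofFn f).take k)
  have run_succ : ∀ k : Fin (ℓ + 1), run (k + 1) = D.step (run k) (f k) := by
    intro k
    have : (List.ofFn f).take (k + 1) = (List.ofFn f).take k ++ [f k] := by
      rw [List.take_add_one, List.getElem?_ofFn]
      simp [k.is_le]
    simp only [run, this, DFA.eval_append_singleton]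
  have run_end : List.ofFn f ∈ D.accepts ↔ run (ℓ + 1) ∈ D.accept := by
    rw [DFA.mem_accepts]
    simp only [run]
    rw [List.take_of_length_le (by simp)]
  have next_top : ∀ (M' : TemporalModel ℓ) (n : Fin (ℓ + 1)),
      (LTL.next .top).Sat M' n ↔ (n : ℕ) < ℓ := fun M' n => by simp [LTL.Sat]
  have letter : ∀ M' : TemporalModel ℓ, (∀ p, p < K ∨ K + Fintype.card σ ≤ p →
      M'.val p = M.val p) → ∀ n c, (χ c).Sat M' n ↔ f n = c := by
    intro M' hM' n c
    rw [← hf n c]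
    exact LTL.sat_congr _ (fun i hi => hM' i (.inl (hi.trans_le (hK c)))) n
  rw [run_end]
  constructor
  · rintro ⟨M', hM', hstart, halways⟩
    rw [LTL.sat_always_zero] at halways
    have step := fun n z => (LTL.sat_imp M' _ _ n).1 ((hψ ℓ M' n).1 (halways n) z)
    have hrun : ∀ k (hk : k < ℓ + 1), (q (run k)).Sat M' ⟨k, hk⟩ := by
      intro k
      induction k with
      | zero => intro _; exact hstart
      | succ k ih =>
        intro hk
        have hk' : k < ℓ + 1 := by omega
        have h := (step ⟨k, hk'⟩ (run k, f ⟨k, hk'⟩) ⟨ih hk', (letter M' hM' _ _).2 rfl⟩).1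
        rw [LTL.sat_imp] at h
        obtain ⟨_, h⟩ := h ((next_top M' _).2 (by simpa using hk))
        rw [run_succ ⟨k, hk'⟩]
        exact h
    have h := (step (Fin.last ℓ) (run ℓ, f (Fin.last ℓ))
      ⟨hrun ℓ (Nat.lt_succ_self ℓ), (letter M' hM' _ _).2 rfl⟩).2
    have hlast := run_succ (Fin.last ℓ)
    simp only [Fin.val_last] at hlast
    rw [hlast]
    by_contra hacc
    simp only [if_neg hacc, next_top, Fin.val_last, lt_self_iff_false] at h
  · intro hacc
    -- The fresh variable of the state `s` is true where `run` is `s`.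
    let M' : TemporalModel ℓ :=
      ⟨fun p => {k | if h : p - K < Fintype.card σ ∧ K ≤ p
        then run k = e.symm ⟨p - K, h.1⟩ else k ∈ M.val p}⟩
    have hM' : ∀ p, p < K ∨ K + Fintype.card σ ≤ p → M'.val p = M.val p := by
      intro p hp
      ext k
      have : ¬ (p - K < Fintype.card σ ∧ K ≤ p) := by omega
      simp [M', this]
    have hq : ∀ s k, (q s).Sat M' k ↔ run k = s := by
      intro s k
      simp [q, M', LTL.Sat]
    refine ⟨M', hM', (hq _ _).2 (by simp [run]), ?_⟩
    rw [LTL.sat_always_zero]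
    intro n
    rw [hψ]
    rintro ⟨s, c⟩
    rw [LTL.sat_imp]
    rintro ⟨hs, hc⟩
    obtain rfl := (hq _ _).1 hs
    obtain rfl := (letter M' hM' _ _).1 hc
    have hstep := run_succ n
    constructor
    · rw [LTL.sat_imp, next_top]
      intro hn
      exact ⟨hn, (hq _ _).2 hstep⟩
    · by_cases hn : (n : ℕ) < ℓ
      · split_ifs
        · trivial
        · exact (next_top M' n).2 hn
      · have hnl : (n : ℕ) = ℓ := by omega
        rw [hnl] at hstep
        simp only [hnl]
        rw [if_pos (hstep ▸ hacc)]
        trivial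

end ELTL

/-! ### From `∃LTL` to monadic second-order logic -/

/-- The standard translation of a formula at the time point `x`. The assignment `ρ` maps the
propositional variables bound by a quantifier to set variables; the other propositional variables
are translated by predicates. -/
def LTL.toMSO {m : ℕ} (ρ : ℕ → Option (Fin m)) : LTL → {n : ℕ} → Fin n → MSO n m
  | .top, _, _ => .top
  | .var i, _, x => (ρ i).elim (.pred i x) (.mem x)
  | .not φ, _, x => .not (φ.toMSO ρ x)
  | .and φ ψ, _, x => .and (φ.toMSO ρ x) (ψ.toMSO ρ x)
  | .next φ, _, x => .ex (.and (.lt x.succ 0)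
      (.and (.not (.ex (.and (.lt x.succ.succ 0) (.lt 0 1)))) (φ.toMSO ρ 0)))
  | .dia φ, _, x => .ex (.and (.lt x.succ 0) (φ.toMSO ρ 0))
  | .untl φ ψ, _, x => .ex (.and (.lt x.succ 0) (.and (φ.toMSO ρ 0)
      (.not (.ex (.and (.lt x.succ.succ 0) (.and (.lt 0 1) (.not (ψ.toMSO ρ 0))))))))

theorem LTL.sat_toMSO {ℓ m : ℕ} {M N : TemporalModel ℓ} {ρ : ℕ → Option (Fin m)}
    {S : Fin m → Set (Fin (ℓ + 1))} (hN : ∀ p, N.val p = (ρ p).elim (M.val p) S) (φ : LTL)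
    {n : ℕ} (x : Fin n) (v : Fin n → Fin (ℓ + 1)) :
    (φ.toMSO ρ x).Sat M v S ↔ φ.Sat N (v x) := by
  induction φ generalizing n with
  | top => rfl
  | var i =>
    simp only [LTL.toMSO, LTL.Sat, hN]
    cases ρ i <;> rfl
  | not φ ih => simp [LTL.toMSO, MSO.Sat, LTL.Sat, ih]
  | and φ ψ ih₁ ih₂ => simp [LTL.toMSO, MSO.Sat, LTL.Sat, ih₁, ih₂]
  | next φ ih =>
    simp only [LTL.toMSO, MSO.Sat, LTL.Sat, ih, Fin.cons_succ, Fin.cons_zero, Fin.cons_one]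
    constructor
    · rintro ⟨a, hxa, hno, ha⟩
      have hlt : (v x : ℕ) < ℓ := by omega
      obtain rfl : a = ⟨v x + 1, Nat.succ_lt_succ hlt⟩ := by
        by_contra hne
        refine hno ⟨⟨v x + 1, Nat.succ_lt_succ hlt⟩, ?_, ?_⟩
        · simp [Fin.lt_def]
        · rw [Fin.lt_def] at hxa ⊢
          rw [Fin.ext_iff] at hne
          simp only at hne ⊢
          omega
      exact ⟨hlt, ha⟩
    · rintro ⟨hlt, h⟩
      refine ⟨_, ?_, ?_, h⟩
      · simp [Fin.lt_def]
      · rintro ⟨b, h1, h2⟩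
        simp only [Fin.lt_def] at h1 h2
        omega
  | dia φ ih => simp [LTL.toMSO, MSO.Sat, LTL.Sat, ih]
  | untl φ ψ ih₁ ih₂ => simp [LTL.toMSO, MSO.Sat, LTL.Sat, ih₁, ih₂]

/-- The standard translation of an `∃LTL`-formula; see `LTL.toMSO`. -/
def ELTL.toMSO : ELTL → {m : ℕ} → (ℕ → Option (Fin m)) → {n : ℕ} → Fin n → MSO n m
  | .ofLTL φ, _, ρ, _, x => φ.toMSO ρ x
  | .ex q φ, _, ρ, _, x =>
    .exSet (φ.toMSO (fun p => if p = q then some 0 else (ρ p).map Fin.succ) x)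

theorem ELTL.sat_toMSO {ℓ m : ℕ} {M N : TemporalModel ℓ} {ρ : ℕ → Option (Fin m)}
    {S : Fin m → Set (Fin (ℓ + 1))} (hN : ∀ p, N.val p = (ρ p).elim (M.val p) S) (φ : ELTL)
    {n : ℕ} (x : Fin n) (v : Fin n → Fin (ℓ + 1)) :
    (φ.toMSO ρ x).Sat M v S ↔ φ.Sat N (v x) := by
  induction φ generalizing m N with
  | ofLTL φ => exact LTL.sat_toMSO hN φ x v
  | ex q φ ih =>
    simp only [ELTL.toMSO, MSO.Sat, ELTL.Sat]
    constructor
    · rintro ⟨B, hB⟩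
      refine ⟨⟨Function.update N.val q B⟩, fun p hp => Function.update_of_ne hp _ _,
        (ih fun p => ?_).1 hB⟩
      by_cases hp : p = q
      · subst hp
        simp
      · simp only [Function.update_of_ne hp, hN, if_neg hp]
        cases ρ p <;> rfl
    · rintro ⟨N', hN', h⟩
      refine ⟨N'.val q, (ih fun p => ?_).2 h⟩
      by_cases hp : p = q
      · subst hp
        simp
      · rw [hN' p hp, hN, if_neg hp]
        cases ρ p <;> rfl

/-! ### Words as temporal models -/

theorem exists_ofFn_eq_wordModel {A : Type*} (ι : A ↪ ℕ) {w : List A} (hw : w ≠ []) :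
    ∃ f : Fin (w.length - 1 + 1) → A, List.ofFn f = w ∧
      ∀ p k, k ∈ (wordModel ι w).val p ↔ ι (f k) = p := by
  cases w with
  | nil => exact (hw rfl).elim
  | cons a w =>
    refine ⟨(a :: w).get, List.ofFn_get _, fun p k => ?_⟩
    have : (a :: w)[(k : ℕ)]? = some ((a :: w).get k) := by
      simp
    change (∃ b, (a :: w)[(k : ℕ)]? = some b ∧ ι b = p) ↔ _
    rw [this]
    simp

theorem mainTheorem5 :
    (∀ θ : MSO 1 0, ∃ φ : ELTL, ∀ (ℓ : ℕ) (M : TemporalModel ℓ),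
      θ.Sat M ![0] ![] ↔ φ.Sat M 0) ∧
    (∀ (A : Type*) [Finite A] (ι : A ↪ ℕ) (L : Language A), [] ∉ L →
      (L.IsRegular ↔ ELTLDefinable ι L)) := by
  classical
  refine ⟨fun θ => ?_, fun A _ ι L hnil => ⟨fun hL => ?_, ?_⟩⟩
  · -- The letters are the truth values of the variables that occur in `θ`.
    obtain ⟨L, hL, h⟩ := MSO.exists_isRegular_atZero
      (fun c : Fin θ.bound → Prop => {i | ∃ hi : i < θ.bound, c ⟨i, hi⟩}) θ
    choose χ hχ using fun c : Fin θ.bound → Prop =>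
      LTL.exists_forall_sat fun i => if c i then LTL.var i else .not (.var i)
    obtain ⟨φ, hφ⟩ := ELTL.exists_of_isRegular χ hL
    refine ⟨φ, fun ℓ M => ?_⟩
    let f : Fin (ℓ + 1) → Fin θ.bound → Prop := fun k i => k ∈ M.val i
    rw [h ℓ M f fun i hi k => by simp [f, hi], hφ ℓ M f fun n c => ?_]
    rw [hχ, funext_iff]
    refine forall_congr' fun i => ?_
    by_cases hc : c i <;> simp [hc, f, LTL.Sat]
  · obtain ⟨φ, hφ⟩ := ELTL.exists_of_isRegular (fun a => LTL.var (ι a)) hL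
    refine ⟨φ, fun w => ?_⟩
    by_cases hw : w = []
    · simp [hw, hnil]
    obtain ⟨f, hf, hval⟩ := exists_ofFn_eq_wordModel ι hw
    rw [hφ _ (wordModel ι w) f fun n c => (hval _ _).trans ι.injective.eq_iff, hf]
    simp [hw]
  · rintro ⟨φ, hφ⟩
    -- The language `L₂` excludes the empty word, on which `L₁` is not determined.
    obtain ⟨L₁, hL₁, h₁⟩ := MSO.exists_isRegular_atZero (fun a => {ι a})
      (φ.toMSO (m := 0) (fun _ => none) 0)
    obtain ⟨L₂, hL₂, h₂⟩ := Language.exists_isRegular_exists_mem (fun _ : A => True)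
    have : L = L₁ ⊓ L₂ := by
      ext w
      rw [hφ, Language.mem_inf, h₂]
      by_cases hw : w = []
      · simp [hw]
      obtain ⟨f, hf, hval⟩ := exists_ofFn_eq_wordModel ι hw
      have hsat := h₁ _ (wordModel ι w) f fun i _ k => by
        rw [hval, Set.mem_singleton_iff, eq_comm]
      rw [ELTL.sat_toMSO (N := wordModel ι w) (fun p => rfl), hf] at hsat
      obtain ⟨c, hc⟩ := List.exists_mem_of_ne_nil w hw
      exact ⟨fun h => ⟨hsat.1 h.2, c, hc, trivial⟩, fun h => ⟨hw, hsat.2 h.1⟩⟩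
    exact this ▸ hL₁.inf hL₂
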